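/- **Setting.** Let $\mathcal C$ and $\mathcal R$ be countable sets of texts (contexts and responses), and let $\Pr$ be a probability distribution on $\mathcal C\times\mathcal R$; write $(C,R)$ for a random pair with this distribution. For discrete random variables $X,Y$ put $$\mathrm{PMI}_{X,Y}(x,y)=\log\frac{\Pr(X=x,Y=y)}{\Pr(X=x)\Pr(Y=y)}\in[-\infty,\infty)\qquad\text{whenever }\Pr(X=x),\Pr(Y=y)>0,$$ with $\log 0=-\infty$. Every context $c$ has a meaning $\mu(c)$ and every response $r$ has a meaning $\mu(r)$. **Assumption 1 (semantic embedding).** An LLM with a fixed prompt gives an embedding $\phi:\mathcal C\times\mathcal R\to\mathbb R^m$ that extracts the semantic meaning: for all $c_1,c_2,r_1,r_2$, $$\phi(c_1,r_1)=\phi(c_2,r_2)\iff \mu(c_1)=\mu(c_2)\text{ and }\mu(r_1)=\mu(r_2).$$ **Assumption 2 (i.i.d. samples).** The data points $(c_1,r_1),(c_2,r_2),\dots$ are independent samples from $\Pr(C,R)$. **PMIScore.** Fix $L\ge 1$. Let $\Theta$ be the set of parameters of all multi-layer perceptrons $s_\theta:\mathbb R^m\to\mathbb R$ with $L$ hidden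 layers of arbitrary widths, each consisting of an affine map followed by a PReLU activation with trainable slope, and with an affine output layer. Put $\mathrm{NN}_\theta=e^{s_\theta}$. The empirical dual-form (NWJ) loss on the first $n\ge 1$ data points, with positive pairs $(c_i,r_i)$ and negative pairs $(c_i,r_j)$, is $$L_n(\theta)=-\Big(\frac1n\sum_{i=1}^n\log \mathrm{NN}_\theta(\phi(c_i,r_i))-\frac1{n^2}\sum_{i,j=1}^n \mathrm{NN}_\theta(\phi(c_i,r_j))\Big).$$ The PMIScore given by the parameters $\theta$ is $\mathrm{PMIS}_\theta(c,r)=\log \mathrm{NN}_\theta(\phi(c,r))$. **Theorem 1.** Under Assumptions 1 and 2, $L_n$ is bounded below on $\Theta$ for every data set and every $n\ge1$. Almost surely, the following holds for all sequences $(\theta_n)$ in $\Theta$ of minimizers, or merely asymptotic minimizers ($L_n(\theta_n)-\inf_\Theta L_n\to0$), of the loss. 1. For all $c,r$ whose meanings have positive probability under the distributions of $\mu(C)$ and of $\mu(R)$, the score converges, as $n\to\infty$, to the pointwise mutual information of the meanings: $$\mathrm{PMIS}_{\theta_n}(c,r)\longrightarrow \mathrm{PMI}_{\mu(C),\mu(R)}(\mu(c),\mu(r)).$$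 2. For all $c,r$ with $\Pr(C=c),\Pr(R=r)>0$ such that $\mathrm{PMI}_{C,R}(c',r')=\mathrm{PMI}_{C,R}(c,r)$ for all $c',r'$ with the same meanings as $c,r$ and with $\Pr(C=c'),\Pr(R=r')>0$ (in particular for all $c,r$ of positive probability if the pointwise mutual information of two texts depends only on their meanings, or if different texts have different meanings), $$\mathrm{PMIS}_{\theta_n}(c,r)\longrightarrow \mathrm{PMI}_{C,R}(c,r).$$ The convergence is in $[-\infty,\infty)$; it includes the case in which the limit is $-\infty$. -/

import Mathlib

open MeasureTheory ProbabilityTheory Filter Topology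

noncomputable section

namespace PMIScore

/-- Pointwise mutual information of `X = x` and `Y = y` under `ν`:
`log (Pr(x, y) / (Pr(x) Pr(y)))`, with value `-∞` when the joint probability vanishes while the
marginal probabilities do not. -/
def pmi {Ω α β : Type*} [MeasurableSpace Ω] (ν : Measure Ω) (X : Ω → α) (Y : Ω → β)
    (x : α) (y : β) : EReal :=
  ENNReal.log (ν {ω | X ω = x ∧ Y ω = y} / (ν {ω | X ω = x} * ν {ω | Y ω = y}))

/-- The embedding `φ` of (context, response) pairs extracts the semantic meaning, where `mC` and
`mR` send a context and a response to its meaning: pairs with the same meaning get the same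
embedding, and the meaning can be read off from the embedding. -/
structure ExtractsMeaning {C R MC MR E : Type*} (mC : C → MC) (mR : R → MR)
    (φ : C × R → E) : Prop where
  invariant : ∀ c₁ c₂ r₁ r₂, mC c₁ = mC c₂ → mR r₁ = mR r₂ → φ (c₁, r₁) = φ (c₂, r₂)
  recoverable : ∀ c₁ c₂ r₁ r₂, φ (c₁, r₁) = φ (c₂, r₂) → mC c₁ = mC c₂ ∧ mR r₁ = mR r₂

/-- The parametric rectifier with slope `a` on the negative half-line. -/
def prelu (a x : ℝ) : ℝ := if 0 ≤ x then x else a * x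

/-- Parameters of a scalar-valued multi-layer perceptron: `MLP L m` has `L` hidden layers, of
arbitrary widths, and input dimension `m`. Every hidden layer is an affine map followed by a
parametric rectifier whose slope is a parameter of the layer. -/
inductive MLP : ℕ → ℕ → Type
  | output {m : ℕ} (w : Fin m → ℝ) (b : ℝ) : MLP 0 m
  | hidden {L m k : ℕ} (W : Matrix (Fin k) (Fin m) ℝ) (b : Fin k → ℝ) (a : ℝ)
      (next : MLP L k) : MLP (L + 1) m

/-- The real output of the perceptron on an input vector. -/
def MLP.eval : {L m : ℕ} → MLP L m → (Fin m → ℝ) → ℝ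
  | _, _, .output w b, x => (∑ i, w i * x i) + b
  | _, _, .hidden W b a next, x => next.eval (fun i => prelu a ((W.mulVec x + b) i))

/-- The positive discriminator `NN_θ : ℝᵐ → ℝ_{>0}` given by a perceptron. -/
def NN {L m : ℕ} (θ : MLP L m) (x : Fin m → ℝ) : ℝ := Real.exp (θ.eval x)

/-- The empirical dual-form loss on the first `n` pairs of the data `d`. The positive pairs are
`(c_i, r_i)`, the negative pairs are all `(c_i, r_j)`, and `φ` is the embedding of pairs. -/
def loss {C R : Type*} {L m : ℕ} (φ : C × R → Fin m → ℝ) (d : ℕ → C × R) (n : ℕ)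
    (θ : MLP L m) : ℝ :=
  -((∑ i ∈ Finset.range n, Real.log (NN θ (φ (d i)))) / n
    - (∑ i ∈ Finset.range n, ∑ j ∈ Finset.range n, NN θ (φ ((d i).1, (d j).2))) / (n : ℝ) ^ 2)

/-- The PMIScore of the pair `(c, r)` given by the parameters `θ`. -/
def score {C R : Type*} {L m : ℕ} (φ : C × R → Fin m → ℝ) (θ : MLP L m) (c : C) (r : R) : ℝ :=
  Real.log (NN θ (φ (c, r)))

/-- `θ` is an asymptotic minimizer of the losses: the gap between the loss of `θ n` and the infimum
of the loss on the first `n` data tends to `0`. Exact minimizers are the case `δ = 0`. -/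
def IsAsymptoticMinimizer {C R : Type*} {L m : ℕ} (φ : C × R → Fin m → ℝ) (d : ℕ → C × R)
    (θ : ℕ → MLP L m) : Prop :=
  ∃ δ : ℕ → ℝ, Tendsto δ atTop (𝓝 0) ∧
    ∀ᶠ n in atTop, ∀ θ' : MLP L m, loss φ d n (θ n) ≤ loss φ d n θ' + δ n

end PMIScore

end

/-! A perceptron with a hidden layer interpolates any values on the finitely many embeddings that
enter `L_n`, so the discriminator value `u` at one pair of meanings can be varied alone. This
changes the loss by the variation of `q u - p log u`, with `p` the joint frequency and `q` the
product of the marginal frequencies (`exists_loss_sub_eq`). An almost minimizer must therefore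
almost minimize this function, which forces `u` close to `p / q` (`sq_sqrt_sub_sqrt_div_le`). The
strong law identifies the limit of `p / q`. The exceptional null set depends only on the data, so no
uniformity over parameters is needed. -/

namespace PMIScore

/-! ### Interpolation by perceptrons -/

/-- On a finite set of reals every function is a linear combination of rectified shifts. -/
theorem exists_relu_interpolation (S : Finset ℝ) (g : ℝ → ℝ) :
    ∃ (k : ℕ) (w b : Fin k → ℝ) (c : ℝ),
      ∀ x ∈ S, (∑ i, w i * prelu 0 (x + b i)) + c = g x := by
  induction S using Finset.induction_on_max with
  | empty => exact ⟨0, Fin.elim0, Fin.elim0, 0, by simp⟩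
  | insert a S hS ih =>
    obtain ⟨k, w, b, c, h⟩ := ih
    rcases S.eq_empty_or_nonempty with rfl | hne
    · exact ⟨0, Fin.elim0, Fin.elim0, g a, by simp⟩
    have hM : 0 < a - S.max' hne := sub_pos.2 (hS _ (S.max'_mem hne))
    set M := S.max' hne
    -- The new unit has its kink at `M = max S`: it vanishes on `S` and equals `a - M > 0` at `a`,
    -- so its weight can correct the value at `a` alone.
    refine ⟨k + 1,
      Fin.cons ((g a - ((∑ i, w i * prelu 0 (a + b i)) + c)) / (a - M)) w,
      Fin.cons (-M) b, c, fun x hx => ?_⟩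
    rw [Fin.sum_univ_succ]
    simp only [Fin.cons_zero, Fin.cons_succ]
    rcases Finset.mem_insert.1 hx with rfl | hx
    · have : prelu 0 (x + -M) = x - M := by
        rw [prelu, if_pos (by linarith)]; ring
      rw [this, div_mul_cancel₀ _ hM.ne']
      ring
    · have hle : x ≤ M := S.le_max' x hx
      have : prelu 0 (x + -M) = 0 := by
        unfold prelu
        split_ifs <;> linarith
      rw [this, ← h x hx]
      ring

/-- Some linear functional is injective on a given finite set of vectors. -/
theorem exists_injOn_dotProduct {m : ℕ} (S : Finset (Fin m → ℝ)) :
    ∃ u : Fin m → ℝ, Set.InjOn (fun x => u ⬝ᵥ x) S := by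
  classical
  -- Injectivity on `S` means not killing any of the finitely many nonzero differences.
  obtain ⟨f, hf⟩ := Module.exists_dual_forall_apply_ne_zero (K := ℝ)
    (fun p : S.offDiag => p.1.1 - p.1.2)
    (fun p => sub_ne_zero.2 (Finset.mem_offDiag.1 p.2).2.2)
  refine ⟨fun i => f (Pi.single i 1), fun x hx y hy hxy => ?_⟩
  by_contra hne
  refine hf ⟨(x, y), Finset.mem_offDiag.2 ⟨hx, hy, hne⟩⟩ ?_
  have key : ∀ z, f z = (fun i => f (Pi.single i 1)) ⬝ᵥ z := fun z => by
    rw [LinearMap.pi_apply_eq_sum_univ f z]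
    refine Finset.sum_congr rfl fun i _ => ?_
    have hsingle : (fun j => if i = j then (1 : ℝ) else 0) = Pi.single i 1 := by
      ext j
      simp [Pi.single_apply, eq_comm]
    rw [hsingle, smul_eq_mul, mul_comm]
  rw [map_sub, key x, key y]
  exact sub_eq_zero.2 hxy

/-- Perceptrons with at least one hidden layer interpolate arbitrary values on finite sets. -/
theorem MLP.exists_interpolation (L : ℕ) {m : ℕ} (S : Finset (Fin m → ℝ))
    (f : (Fin m → ℝ) → ℝ) : ∃ θ : MLP (L + 1) m, ∀ x ∈ S, θ.eval x = f x := by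
  induction L with
  | zero =>
    classical
    obtain ⟨u, hu⟩ := exists_injOn_dotProduct S
    obtain ⟨k, w, b, c, h⟩ := exists_relu_interpolation (S.image (fun x => u ⬝ᵥ x))
      (fun t => f (Function.invFunOn (fun x => u ⬝ᵥ x) S t))
    refine ⟨.hidden (fun _ => u) b 0 (.output w c), fun x hx => ?_⟩
    have := h _ (Finset.mem_image_of_mem _ hx)
    rw [hu.leftInvOn_invFunOn hx] at this
    exact this
  | succ L ih =>
    obtain ⟨θ, hθ⟩ := ih
    -- With slope `1` the rectifier is the identity, so this layer passes its input on unchanged.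
    refine ⟨.hidden 1 0 1 θ, fun x hx => ?_⟩
    rw [← hθ x hx]
    simp [MLP.eval, prelu]

/-! ### The empirical loss -/

theorem NN_pos {L m : ℕ} (θ : MLP L m) (x : Fin m → ℝ) : 0 < NN θ x := Real.exp_pos _

/-- The positive pairs are the diagonal of the negative ones, and `log x ≤ x / n + log n` lets the
negative term absorb the positive one up to `log n`. -/
theorem bddBelow_loss {C R : Type*} {L m : ℕ} (φ : C × R → Fin m → ℝ) (d : ℕ → C × R) (n : ℕ) :
    BddBelow (Set.range (fun θ : MLP L m => loss φ d n θ)) := by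
  rcases n.eq_zero_or_pos with rfl | hn
  · exact ⟨0, by rintro _ ⟨θ, rfl⟩; simp [loss]⟩
  have hn' : (0 : ℝ) < n := by exact_mod_cast hn
  refine ⟨-Real.log n, ?_⟩
  rintro _ ⟨θ, rfl⟩
  have hdiag : ∑ i ∈ Finset.range n, NN θ (φ (d i))
      ≤ ∑ i ∈ Finset.range n, ∑ j ∈ Finset.range n, NN θ (φ ((d i).1, (d j).2)) :=
    Finset.sum_le_sum fun i hi =>
      Finset.single_le_sum (f := fun j => NN θ (φ ((d i).1, (d j).2)))
        (fun j _ => (NN_pos θ _).le) hi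
  have hterm : ∑ i ∈ Finset.range n, Real.log (NN θ (φ (d i)))
      ≤ ∑ i ∈ Finset.range n, (NN θ (φ (d i)) / n + Real.log n) := by
    refine Finset.sum_le_sum fun i _ => ?_
    have h1 := Real.log_le_sub_one_of_pos (div_pos (NN_pos θ (φ (d i))) hn')
    rw [Real.log_div (NN_pos θ _).ne' hn'.ne'] at h1
    linarith
  rw [Finset.sum_add_distrib, ← Finset.sum_div, Finset.sum_const, Finset.card_range,
    nsmul_eq_mul] at hterm
  have h1 := (div_le_div_iff_of_pos_right hn').2 hterm
  have h2 := (div_le_div_iff_of_pos_right (pow_pos hn' 2)).2 hdiag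
  rw [add_div, mul_div_cancel_left₀ _ hn'.ne', div_div, ← sq] at h1
  simp only [loss]
  linarith

/-- The relative frequency of the set `A` among the first `n` data points. -/
noncomputable def frequency {α : Type*} (d : ℕ → α) (A : Set α) (n : ℕ) : ℝ :=
  (∑ i ∈ Finset.range n, A.indicator (fun _ => (1 : ℝ)) (d i)) / n

theorem frequency_nonneg {α : Type*} (d : ℕ → α) (A : Set α) (n : ℕ) : 0 ≤ frequency d A n :=
  div_nonneg (Finset.sum_nonneg fun _ _ => Set.indicator_nonneg (fun _ _ => zero_le_one) _)
    n.cast_nonneg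

/-- The discriminator at one pair of meanings can be set to any positive value `w` while it is kept
at all other data; the loss changes by the difference of `u ↦ q u - p log u` at the two values,
where `p` is the frequency of the pair and `q` is the product of the marginal frequencies. -/
theorem exists_loss_sub_eq {C R MC MR : Type*} {L m : ℕ} {mC : C → MC} {mR : R → MR}
    {φ : C × R → Fin m → ℝ} (hφ : ExtractsMeaning mC mR φ) (d : ℕ → C × R) (n : ℕ)
    (θ : MLP (L + 1) m) (c : C) (r : R) {w : ℝ} (hw : 0 < w) :
    ∃ θ' : MLP (L + 1) m, loss φ d n θ - loss φ d n θ' =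
      frequency d {x | mC x.1 = mC c} n * frequency d {x | mR x.2 = mR r} n *
          (NN θ (φ (c, r)) - w) -
        frequency d {x | mC x.1 = mC c ∧ mR x.2 = mR r} n *
          (Real.log (NN θ (φ (c, r))) - Real.log w) := by
  classical
  obtain ⟨θ', hθ'⟩ := MLP.exists_interpolation L
    (Finset.image₂ (fun i j => φ ((d i).1, (d j).2)) (Finset.range n) (Finset.range n))
    (Function.update θ.eval (φ (c, r)) (Real.log w))
  have hiff : ∀ c' r', φ (c', r') = φ (c, r) ↔ mC c' = mC c ∧ mR r' = mR r := fun c' r' =>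
    ⟨hφ.recoverable _ _ _ _, fun h => hφ.invariant _ _ _ _ h.1 h.2⟩
  have hpos : ∀ i ∈ Finset.range n, Real.log (NN θ' (φ (d i))) = Real.log (NN θ (φ (d i))) +
      {x : C × R | mC x.1 = mC c ∧ mR x.2 = mR r}.indicator (fun _ => (1 : ℝ)) (d i) *
        (Real.log w - Real.log (NN θ (φ (c, r)))) := by
    intro i hi
    have h := hθ' _ (Finset.mem_image₂_of_mem hi hi)
    simp only [NN, Real.log_exp, Prod.mk.eta] at h ⊢
    rw [h, Function.update_apply]
    have := hiff (d i).1 (d i).2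
    by_cases hm : mC (d i).1 = mC c ∧ mR (d i).2 = mR r
    · rw [if_pos (this.2 hm), show φ (d i) = φ (c, r) from this.2 hm]
      simp [hm]
    · rw [if_neg (fun h => hm (this.1 h))]
      simp [hm]
  have hneg : ∀ i ∈ Finset.range n, ∀ j ∈ Finset.range n,
      NN θ' (φ ((d i).1, (d j).2)) = NN θ (φ ((d i).1, (d j).2)) +
      {x : C × R | mC x.1 = mC c}.indicator (fun _ => (1 : ℝ)) (d i) *
      ({x : C × R | mR x.2 = mR r}.indicator (fun _ => (1 : ℝ)) (d j) *
        (w - NN θ (φ (c, r)))) := by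
    intro i hi j hj
    have h := hθ' _ (Finset.mem_image₂_of_mem hi hj)
    simp only [NN]
    rw [h, Function.update_apply]
    have := hiff (d i).1 (d j).2
    by_cases h1 : mC (d i).1 = mC c <;> by_cases h2 : mR (d j).2 = mR r
    · rw [if_pos (this.2 ⟨h1, h2⟩), this.2 ⟨h1, h2⟩, Real.exp_log hw]
      simp [h1, h2]
    · rw [if_neg (fun h => h2 (this.1 h).2)]
      simp [h2]
    · rw [if_neg (fun h => h1 (this.1 h).1)]
      simp [h1]
    · rw [if_neg (fun h => h1 (this.1 h).1)]
      simp [h1]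
  refine ⟨θ', ?_⟩
  -- Over all pairs `(i, j)` the indicator factorizes, which produces the product of the marginal
  -- counts.
  have hsum : ∑ i ∈ Finset.range n, ∑ j ∈ Finset.range n, NN θ' (φ ((d i).1, (d j).2)) =
      (∑ i ∈ Finset.range n, ∑ j ∈ Finset.range n, NN θ (φ ((d i).1, (d j).2))) +
      (∑ i ∈ Finset.range n, {x : C × R | mC x.1 = mC c}.indicator (fun _ => (1 : ℝ)) (d i)) *
      ((∑ j ∈ Finset.range n, {x : C × R | mR x.2 = mR r}.indicator (fun _ => (1 : ℝ)) (d j)) *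
        (w - NN θ (φ (c, r)))) := by
    rw [Finset.sum_mul, Finset.sum_mul, ← Finset.sum_add_distrib]
    refine Finset.sum_congr rfl fun i hi => ?_
    rw [Finset.sum_congr rfl (hneg i hi), Finset.sum_add_distrib, ← Finset.mul_sum]
  simp only [loss, frequency]
  rw [hsum, Finset.sum_congr rfl hpos, Finset.sum_add_distrib, ← Finset.sum_mul]
  ring

/-! ### Convergence of asymptotic minimizers -/

/-- The gap of `u ↦ u - t log u` above its minimum controls the distance of `u` to `t`. -/
theorem sq_sqrt_sub_sqrt_le {u t : ℝ} (hu : 0 < u) (ht : 0 < t) :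
    (√u - √t) ^ 2 ≤ u - t - t * (Real.log u - Real.log t) := by
  -- Applying `log x ≤ x - 1` to `√u / √t` rather than `u / t` leaves exactly the square `u + t - 2
  -- √u √t`.
  have h := Real.log_le_sub_one_of_pos (div_pos (Real.sqrt_pos.2 hu) (Real.sqrt_pos.2 ht))
  rw [Real.log_div (Real.sqrt_pos.2 hu).ne' (Real.sqrt_pos.2 ht).ne', Real.log_sqrt hu.le,
    Real.log_sqrt ht.le] at h
  have h2 := mul_le_mul_of_nonneg_left h (by linarith : 0 ≤ 2 * t)
  have h3 : t * (√u / √t) = √u * √t := by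
    rw [mul_div_assoc', div_eq_iff (Real.sqrt_pos.2 ht).ne', mul_assoc, Real.mul_self_sqrt ht.le]
    ring
  nlinarith [Real.sq_sqrt hu.le, Real.sq_sqrt ht.le]

/-- A positive `δ`-minimizer of `u ↦ q u - p log u` is close to `p / q`. -/
theorem sq_sqrt_sub_sqrt_div_le {p q u δ : ℝ} (hp : 0 ≤ p) (hq : 0 < q) (hu : 0 < u)
    (h : ∀ w, 0 < w → q * (u - w) - p * (Real.log u - Real.log w) ≤ δ) :
    (√u - √(p / q)) ^ 2 ≤ δ / q := by
  rw [le_div_iff₀ hq]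
  rcases hp.eq_or_lt with rfl | hp
  · rw [zero_div, Real.sqrt_zero, sub_zero, Real.sq_sqrt hu.le]
    refine le_of_forall_pos_le_add fun ε hε => ?_
    -- For `p = 0` the infimum is only approached as `w → 0`.
    have := h (ε / q) (div_pos hε hq)
    rw [mul_sub, mul_div_cancel₀ _ hq.ne'] at this
    linarith
  · have ht := div_pos hp hq
    have h1 := mul_le_mul_of_nonneg_right (sq_sqrt_sub_sqrt_le hu ht) hq.le
    have h2 := h _ ht
    have h3 : p / q * q = p := div_mul_cancel₀ _ hq.ne'
    have h4 : (u - p / q - p / q * (Real.log u - Real.log (p / q))) * q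
        = q * (u - p / q) - p / q * q * (Real.log u - Real.log (p / q)) := by ring
    rw [h4, h3] at h1
    exact h1.trans h2

/-- The square-root bound needs no positive lower bound on `p`, so `p₀ = 0` is covered. -/
theorem tendsto_div_of_asymptotic_minimizer {p q u δ : ℕ → ℝ} {p₀ q₀ : ℝ}
    (hp : Tendsto p atTop (𝓝 p₀)) (hq : Tendsto q atTop (𝓝 q₀)) (hδ : Tendsto δ atTop (𝓝 0))
    (hp0 : ∀ n, 0 ≤ p n) (hq₀ : 0 < q₀) (hu : ∀ n, 0 < u n)
    (h : ∀ᶠ n in atTop, ∀ w, 0 < w →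
      q n * (u n - w) - p n * (Real.log (u n) - Real.log w) ≤ δ n) :
    Tendsto u atTop (𝓝 (p₀ / q₀)) := by
  have ht : Tendsto (fun n => √(p n / q n)) atTop (𝓝 √(p₀ / q₀)) :=
    (Real.continuous_sqrt.tendsto _).comp (hp.div hq hq₀.ne')
  have hsq : Tendsto (fun n => (√(u n) - √(p n / q n)) ^ 2) atTop (𝓝 0) := by
    have hlim : Tendsto (fun n => δ n / q n) atTop (𝓝 0) :=
      zero_div q₀ ▸ hδ.div hq hq₀.ne'
    refine squeeze_zero' (Eventually.of_forall fun n => sq_nonneg _) ?_ hlim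
    filter_upwards [h, hq.eventually (lt_mem_nhds hq₀)] with n hn hqn
    exact sq_sqrt_sub_sqrt_div_le (hp0 n) hqn (hu n) hn
  have hdiff : Tendsto (fun n => √(u n) - √(p n / q n)) atTop (𝓝 0) := by
    have := (Real.continuous_sqrt.tendsto _).comp hsq
    simp only [Function.comp_def, Real.sqrt_sq_eq_abs, Real.sqrt_zero] at this
    exact (tendsto_zero_iff_abs_tendsto_zero _).2 this
  have hsqrt : Tendsto (fun n => √(u n)) atTop (𝓝 √(p₀ / q₀)) := by
    simpa using hdiff.add ht
  have hp₀ : 0 ≤ p₀ := ge_of_tendsto' hp hp0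
  have := hsqrt.pow 2
  simpa [Real.sq_sqrt (hu _).le, Real.sq_sqrt (div_nonneg hp₀ hq₀.le)] using this

/-- The strong law of large numbers for the relative frequency of an event. -/
theorem ae_tendsto_frequency {Ω α : Type*} [MeasurableSpace Ω] [MeasurableSpace α]
    {P : Measure Ω} [IsProbabilityMeasure P] {ν : Measure α} {D : ℕ → Ω → α}
    (hlaw : ∀ i, HasLaw (D i) ν P) (hindep : iIndepFun D P) {A : Set α} (hA : MeasurableSet A) :
    ∀ᵐ ω ∂P, Tendsto (fun n => frequency (fun i => D i ω) A n) atTop (𝓝 (ν.real A)) := by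
  have hf : Measurable (A.indicator fun _ => (1 : ℝ)) := measurable_const.indicator hA
  have hint : ∫ ω, A.indicator (fun _ => (1 : ℝ)) (D 0 ω) ∂P = ν.real A := by
    rw [← integral_map (hlaw 0).aemeasurable hf.aestronglyMeasurable, (hlaw 0).map_eq,
      integral_indicator_const _ hA, smul_eq_mul, mul_one]
  rw [← hint]
  refine strong_law_ae_real (fun i ω => A.indicator (fun _ => (1 : ℝ)) (D i ω)) ?_ ?_ ?_
  · refine Integrable.of_bound (C := 1)
      (hf.comp_aemeasurable (hlaw 0).aemeasurable).aestronglyMeasurable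
      (Eventually.of_forall fun ω => ?_)
    refine (norm_indicator_le_norm_self _ _).trans ?_
    simp
  · intro i j hij
    exact (hindep.indepFun hij).comp hf hf
  · intro i
    exact ((hlaw i).identDistrib (hlaw 0)).comp hf

theorem tendsto_score {C R MC MR : Type*} [MeasurableSpace C] [MeasurableSpace R]
    {ν : Measure (C × R)} [IsProbabilityMeasure ν]
    {L m : ℕ} {mC : C → MC} {mR : R → MR}
    {φ : C × R → Fin m → ℝ} (hφ : ExtractsMeaning mC mR φ) {d : ℕ → C × R}
    {θ : ℕ → MLP (L + 1) m} (hθ : IsAsymptoticMinimizer φ d θ) {c : C} {r : R}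
    (hc : ν {x | mC x.1 = mC c} ≠ 0) (hr : ν {x | mR x.2 = mR r} ≠ 0)
    (hdC : Tendsto (frequency d {x | mC x.1 = mC c}) atTop (𝓝 (ν.real {x | mC x.1 = mC c})))
    (hdR : Tendsto (frequency d {x | mR x.2 = mR r}) atTop (𝓝 (ν.real {x | mR x.2 = mR r})))
    (hd : Tendsto (frequency d {x | mC x.1 = mC c ∧ mR x.2 = mR r}) atTop
      (𝓝 (ν.real {x | mC x.1 = mC c ∧ mR x.2 = mR r}))) :
    Tendsto (fun n => (score φ (θ n) c r : EReal)) atTop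
      (𝓝 (pmi ν (fun x => mC x.1) (fun x => mR x.2) (mC c) (mR r))) := by
  obtain ⟨δ, hδ, hmin⟩ := hθ
  have hq : 0 < ν.real {x | mC x.1 = mC c} * ν.real {x | mR x.2 = mR r} :=
    mul_pos (ENNReal.toReal_pos hc (measure_ne_top _ _))
      (ENNReal.toReal_pos hr (measure_ne_top _ _))
  have hlim := tendsto_div_of_asymptotic_minimizer hd (hdC.mul hdR) hδ
    (frequency_nonneg _ _) hq (fun n => NN_pos (θ n) (φ (c, r))) (by
      filter_upwards [hmin] with n hn w hw
      obtain ⟨θ', h⟩ := exists_loss_sub_eq hφ d n (θ n) c r hw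
      rw [← h]
      linarith [hn θ'])
  -- The extended logarithm is continuous at `0` too, which handles the limit `-∞`.
  have hlog := (ENNReal.continuous_log.tendsto _).comp (ENNReal.tendsto_ofReal hlim)
  simp only [Function.comp_def, ENNReal.log_ofReal_of_pos (NN_pos _ _)] at hlog
  rw [ENNReal.ofReal_div_of_pos hq, ENNReal.ofReal_mul measureReal_nonneg,
    ofReal_measureReal, ofReal_measureReal, ofReal_measureReal] at hlog
  exact hlog

/-! ### Pointwise mutual information of texts and of meanings -/

/-- On the rectangle of texts with the given meanings, the joint law has constant density `k` with
respect to the product of its marginals; summing over the rectangle gives the same ratio for the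
meanings. -/
theorem pmi_eq_of_const {C R MC MR : Type*} [Countable C] [MeasurableSpace C]
    [MeasurableSingletonClass C] [Countable R] [MeasurableSpace R] [MeasurableSingletonClass R]
    {ν : Measure (C × R)} [IsProbabilityMeasure ν] {mC : C → MC} {mR : R → MR} {c : C} {r : R}
    (hc : ν {x | x.1 = c} ≠ 0) (hr : ν {x | x.2 = r} ≠ 0)
    (h : ∀ (c' : C) (r' : R), mC c' = mC c → mR r' = mR r →
      ν {x | x.1 = c'} ≠ 0 → ν {x | x.2 = r'} ≠ 0 →
      pmi ν Prod.fst Prod.snd c' r' = pmi ν Prod.fst Prod.snd c r) :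
    pmi ν (fun x => mC x.1) (fun x => mR x.2) (mC c) (mR r) = pmi ν Prod.fst Prod.snd c r := by
  set k := ν {x | x.1 = c ∧ x.2 = r} / (ν {x | x.1 = c} * ν {x | x.2 = r})
  set π := (ν.map Prod.fst).prod (ν.map Prod.snd)
  set A := {x : C × R | mC x.1 = mC c ∧ mR x.2 = mR r}
  have hmap : IsProbabilityMeasure (ν.map Prod.fst) :=
    Measure.isProbabilityMeasure_map measurable_fst.aemeasurable
  have hmap' : IsProbabilityMeasure (ν.map Prod.snd) :=
    Measure.isProbabilityMeasure_map measurable_snd.aemeasurable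
  have hfst : ∀ s : Set C, ν.map Prod.fst s = ν {x | x.1 ∈ s} := fun s =>
    Measure.map_apply measurable_fst (Set.to_countable s).measurableSet
  have hsnd : ∀ s : Set R, ν.map Prod.snd s = ν {x | x.2 ∈ s} := fun s =>
    Measure.map_apply measurable_snd (Set.to_countable s).measurableSet
  have hpoint : ∀ c' r', mC c' = mC c → mR r' = mR r →
      ν {(c', r')} = k * (ν {x | x.1 = c'} * ν {x | x.2 = r'}) := by
    intro c' r' hc' hr'
    have hset : ({(c', r')} : Set (C × R)) = {x | x.1 = c' ∧ x.2 = r'} := by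
      ext ⟨a, b⟩; simp
    rw [hset]
    -- Where a marginal vanishes, so does the joint mass, and the constancy hypothesis is not
    -- needed.
    by_cases h1 : ν {x | x.1 = c'} = 0
    · rw [h1, zero_mul, mul_zero]
      exact measure_mono_null (fun x hx => hx.1) h1
    by_cases h2 : ν {x | x.2 = r'} = 0
    · rw [h2, mul_zero, mul_zero]
      exact measure_mono_null (fun x hx => hx.2) h2
    have := ENNReal.log_injective (h c' r' hc' hr' h1 h2)
    rw [show k = _ from this.symm, ENNReal.div_mul_cancel (mul_ne_zero h1 h2)
      (ENNReal.mul_ne_top (measure_ne_top _ _) (measure_ne_top _ _))]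
  have hrestrict : ν.restrict A = (k • π).restrict A := by
    refine Measure.ext_of_singleton fun x => ?_
    rw [Measure.restrict_apply (measurableSet_singleton x),
      Measure.restrict_apply (measurableSet_singleton x)]
    by_cases hx : x ∈ A
    · rw [Set.inter_eq_left.2 (Set.singleton_subset_iff.2 hx)]
      obtain ⟨a, b⟩ := x
      rw [hpoint a b hx.1 hx.2, Measure.smul_apply, smul_eq_mul, ← Set.singleton_prod_singleton,
        Measure.prod_prod, hfst, hsnd]
      rfl
    · rw [Set.singleton_inter_eq_empty.2 hx, measure_empty, measure_empty]
  have hA : ν A = k * (ν {x | mC x.1 = mC c} * ν {x | mR x.2 = mR r}) := by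
    have h1 := congrArg (fun μ : Measure (C × R) => μ A) hrestrict
    simp only [Measure.restrict_apply_self, Measure.smul_apply, smul_eq_mul] at h1
    rw [h1, show A = {a | mC a = mC c} ×ˢ {b | mR b = mR r} from rfl, Measure.prod_prod, hfst,
      hsnd]
    rfl
  have hc' : ν {x | mC x.1 = mC c} ≠ 0 := fun h0 =>
    hc (measure_mono_null (fun x hx => congrArg mC hx) h0)
  have hr' : ν {x | mR x.2 = mR r} ≠ 0 := fun h0 =>
    hr (measure_mono_null (fun x hx => congrArg mR hx) h0)
  refine congrArg ENNReal.log ?_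
  change ν A / _ = k
  rw [hA, ENNReal.mul_div_cancel_right (mul_ne_zero hc' hr')
    (ENNReal.mul_ne_top (measure_ne_top _ _) (measure_ne_top _ _))]

end PMIScore

theorem theorem1
    {Ω C R MC MR Prompt : Type*} [MeasurableSpace Ω]
    [Countable C] [MeasurableSpace C] [MeasurableSingletonClass C]
    [Countable R] [MeasurableSpace R] [MeasurableSingletonClass R]
    (P : Measure Ω) [IsProbabilityMeasure P]
    -- the joint distribution of a context and a response
    (ν : Measure (C × R)) [IsProbabilityMeasure ν]
    -- the meanings of contexts and of responses
    (mC : C → MC) (mR : R → MR)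
    -- the embedding oracle and the prompt, which extract the semantic meaning
    (m : ℕ) (Φ : Prompt → C × R → Fin m → ℝ) (p : Prompt)
    (hΦ : PMIScore.ExtractsMeaning mC mR (Φ p))
    -- the data points are i.i.d. samples of the joint distribution
    (D : ℕ → Ω → C × R) (hlaw : ∀ i, HasLaw (D i) ν P) (hindep : iIndepFun D P)
    -- the number of hidden layers
    (L : ℕ) (hL : 1 ≤ L) :
    -- on every data set the loss is bounded below, so that asymptotic minimizers exist
    (∀ (d : ℕ → C × R) (n : ℕ),
      BddBelow (Set.range (fun θ : PMIScore.MLP L m => PMIScore.loss (Φ p) d n θ))) ∧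
    -- almost surely, for all asymptotic minimizers, the score converges to the PMI
    ∀ᵐ ω ∂P, ∀ θ : ℕ → PMIScore.MLP L m,
      PMIScore.IsAsymptoticMinimizer (Φ p) (fun i => D i ω) θ →
      (∀ (c : C) (r : R),
        ν {x | mC x.1 = mC c} ≠ 0 → ν {x | mR x.2 = mR r} ≠ 0 →
        Tendsto (fun n => (PMIScore.score (Φ p) (θ n) c r : EReal)) atTop
          (𝓝 (PMIScore.pmi ν (fun x => mC x.1) (fun x => mR x.2) (mC c) (mR r)))) ∧
      (∀ (c : C) (r : R),
        ν {x | x.1 = c} ≠ 0 → ν {x | x.2 = r} ≠ 0 →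
        (∀ (c' : C) (r' : R), mC c' = mC c → mR r' = mR r →
          ν {x | x.1 = c'} ≠ 0 → ν {x | x.2 = r'} ≠ 0 →
          PMIScore.pmi ν Prod.fst Prod.snd c' r' = PMIScore.pmi ν Prod.fst Prod.snd c r) →
        Tendsto (fun n => (PMIScore.score (Φ p) (θ n) c r : EReal)) atTop
          (𝓝 (PMIScore.pmi ν Prod.fst Prod.snd c r))) := by
  obtain ⟨l, rfl⟩ : ∃ l, L = l + 1 := ⟨L - 1, by omega⟩
  refine ⟨PMIScore.bddBelow_loss _, ?_⟩
  -- Indexing the events by texts keeps them countable in number and needs no measurable structure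
  -- on meanings.
  have hC : ∀ᵐ ω ∂P, ∀ c : C, Tendsto (PMIScore.frequency (fun i => D i ω) {x | mC x.1 = mC c})
      atTop (𝓝 (ν.real {x | mC x.1 = mC c})) :=
    ae_all_iff.2 fun c =>
      PMIScore.ae_tendsto_frequency hlaw hindep (Set.to_countable _).measurableSet
  have hR : ∀ᵐ ω ∂P, ∀ r : R, Tendsto (PMIScore.frequency (fun i => D i ω) {x | mR x.2 = mR r})
      atTop (𝓝 (ν.real {x | mR x.2 = mR r})) :=
    ae_all_iff.2 fun r =>
      PMIScore.ae_tendsto_frequency hlaw hindep (Set.to_countable _).measurableSet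
  have hCR : ∀ᵐ ω ∂P, ∀ (c : C) (r : R),
      Tendsto (PMIScore.frequency (fun i => D i ω) {x | mC x.1 = mC c ∧ mR x.2 = mR r})
        atTop (𝓝 (ν.real {x | mC x.1 = mC c ∧ mR x.2 = mR r})) :=
    ae_all_iff.2 fun c => ae_all_iff.2 fun r =>
      PMIScore.ae_tendsto_frequency hlaw hindep (Set.to_countable _).measurableSet
  filter_upwards [hC, hR, hCR] with ω hC hR hCR θ hθ
  have key : ∀ (c : C) (r : R),
      ν {x | mC x.1 = mC c} ≠ 0 → ν {x | mR x.2 = mR r} ≠ 0 →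
      Tendsto (fun n => (PMIScore.score (Φ p) (θ n) c r : EReal)) atTop
        (𝓝 (PMIScore.pmi ν (fun x => mC x.1) (fun x => mR x.2) (mC c) (mR r))) :=
    fun c r hc hr => PMIScore.tendsto_score hΦ hθ hc hr (hC c) (hR r) (hCR c r)
  refine ⟨key, fun c r hc hr h => ?_⟩
  rw [← PMIScore.pmi_eq_of_const hc hr h]
  exact key c r (fun h0 => hc (measure_mono_null (fun x hx => congrArg mC hx) h0))
    (fun h0 => hr (measure_mono_null (fun x hx => congrArg mR hx) h0))
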